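/- Let $(u_n)_{n\ge 0}$ be a sequence of complex-valued functions of $z\in\mathbb{C}$ (for instance meromorphic functions) that is holonomic in $(n,z)$, i.e. satisfies a compatible system of linear recurrences in $n$ and $z$ with coefficients in $\mathbb{Q}(n,z)$, of finite rank: there is $N$ such that for all integers $i,j\ge 0$ there are $c_{ab}\in\mathbb{Q}(n,z)$ ($0\le a,b<N$) with $$u_{n+i}(z+j)=\sum_{0\le a,b<N}c_{ab}(n,z)\,u_{n+a}(z+b)$$ for all sufficiently large $n$, as an identity of functions of $z$ off a closed discrete subset of $\mathbb{C}$ (which may depend on $n$). Let $$\Lambda(n,z)=\lambda^n\,n^{\rho(z)}\prod_{j=1}^{s}\Gamma(n+\alpha_j z+\beta_j)^{m_j},$$ where $\lambda\in\mathbb{C}^*$, $\rho(z)=c_1z+c_0$ with $c_1\in\mathbb{Z}$ and $c_0\in\mathbb{C}$, and $\alpha_j,m_j\in\mathbb{Z}$, $\beta_j\in\mathbb{C}$. Let $h$ be a meromorphic function on $\mathbb{C}$ such that, for all $z$ outside a closed discrete subset of $\mathbb{C}$, $$u_n(z)\sim\Lambda(n,z)\,h(z)\qquad(n\to\infty).$$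 Then $h$ satisfies a homogeneous additive functional equation with rational coefficients: there are $r\ge 0$ and $R_0,\dots,R_r\in\mathbb{Q}(z)$ with $R_0\not\equiv 0$ and $R_r\not\equiv 0$ such that $$\sum_{k=0}^{r}R_k(z)\,h(z+k)=0$$ as an identity of meromorphic functions on $\mathbb{C}$. -/

import Mathlib

open Filter Topology Asymptotics

noncomputable section

namespace HolonomicAFE

/-- The field `ℚ(n, z)` of rational functions in two variables, as the fraction field of `ℚ[z][n]`
(the outer polynomial variable is `n`, the inner one is `z`). -/
abbrev RatNZ : Type := FractionRing (Polynomial (Polynomial ℚ))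

/-- The value of a polynomial `p ∈ ℚ[z][n]` at an integer `n ≥ 0` and a complex number `z`. -/
def evalPoly (p : Polynomial (Polynomial ℚ)) (n : ℕ) (z : ℂ) : ℂ :=
  p.eval₂ (Polynomial.eval₂RingHom (algebraMap ℚ ℂ) z) (n : ℂ)

/-- The value of a rational function `a ∈ ℚ(n, z)` at `(n, z)`, computed from its reduced fraction.
It is meaningful where the reduced denominator does not vanish; for all large `n` that is the case
for all `z` outside a finite set. -/
def evalRat (a : RatNZ) (n : ℕ) (z : ℂ) : ℂ :=
  evalPoly (IsFractionRing.num (Polynomial (Polynomial ℚ)) a) n z /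
    evalPoly (IsFractionRing.den (Polynomial (Polynomial ℚ)) a : Polynomial (Polynomial ℚ)) n z

/-- `u_n(z)` is holonomic in `(n, z)` over `ℚ(n, z)`: it satisfies a system of linear recurrences in
the shifts `n ↦ n + 1` and `z ↦ z + 1`, with coefficients in `ℚ(n, z)`, of finite rank. In other
words, all the shifts `u_{n+i}(z+j)` are linear combinations over `ℚ(n, z)` of finitely many of them.
This is the case exactly when `u` satisfies one nontrivial recurrence in pure shifts of `n` and one in
pure shifts of `z`; systems that mix the two kinds of shifts are covered as well.

A relation is required for all large `n` and, for each such `n`, as an identity between functions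
of `z` off a closed discrete set (poles of the `u_n`, zeros of the denominators). -/
def IsHolonomic (u : ℕ → ℂ → ℂ) : Prop :=
  ∃ N : ℕ, ∀ i j : ℕ, ∃ c : Fin N → Fin N → RatNZ,
    ∀ᶠ n : ℕ in atTop, ∀ᶠ z : ℂ in codiscrete ℂ,
      u (n + i) (z + j) =
        ∑ a : Fin N, ∑ b : Fin N, evalRat (c a b) n z * u (n + a) (z + b)

/-- The integer-slope shell
`Λ(n, z) = l ^ n * n ^ (c₁ z + c₀) * ∏ j, Γ(n + α j * z + β j) ^ (m j)`. -/
def shell (l : ℂ) (c₁ : ℤ) (c₀ : ℂ) {s : ℕ} (α : Fin s → ℤ) (β : Fin s → ℂ) (m : Fin s → ℤ)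
    (n : ℕ) (z : ℂ) : ℂ :=
  l ^ n * (n : ℂ) ^ ((c₁ : ℂ) * z + c₀) *
    ∏ j : Fin s, Complex.Gamma ((n : ℂ) + (α j : ℂ) * z + β j) ^ (m j)

/-- `h` satisfies a homogeneous additive functional equation `∑_{k=0}^r R_k(z) h(z+k) = 0` of order
`r` with coefficients `R_k ∈ ℚ(z)`, where `R_0 ≠ 0` and `R_r ≠ 0`. The equation is an identity of
meromorphic functions, that is, it holds off a closed discrete subset of `ℂ`. -/
def SatisfiesAFE (h : ℂ → ℂ) (r : ℕ) : Prop :=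
  ∃ R : ℕ → RatFunc ℚ, R 0 ≠ 0 ∧ R r ≠ 0 ∧
    ∀ᶠ z : ℂ in codiscrete ℂ,
      ∑ k ∈ Finset.range (r + 1), (R k).eval (algebraMap ℚ ℂ) z * h (z + k) = 0

end HolonomicAFE

end

/-!
The field `ℚ(n, z)` turns finite rank into one pure recurrence in `z`: among the `N² + 1` shifts
`u_n(z), …, u_n(z + N²)`, all lying in the span of the `N²` generators, there is a nontrivial relation
`∑ j, P_j(n, z) u_n(z + j) = 0` with `P_j ∈ ℚ[z][n]` (`exists_shift_relation`). To make sense of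
coefficients in `ℚ(n, z)` at a given `z`, take `z` transcendental: then every nonzero polynomial in
`ℚ[z][n]` is nonzero at `(n, z)` for all large `n`, so that evaluation is a ring homomorphism from
`ℚ(n, z)` to germs of sequences at `n = ∞` (`ratGerm`). Only countably many `z` are lost.

All slopes being integers, `Λ(n, z + j) ~ n ^ (δ j) Λ(n, z)` with `δ = c₁ + ∑ i, α_i m_i`
(`shell_shift_isEquivalent`). Hence the `j`-th term of the relation, divided by `Λ(n, z)`, is of order
`n ^ (deg_n P_j + δ j)`, with constant the leading coefficient of `P_j` times `h(z + j)`. Dividing by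
the largest of these powers and letting `n → ∞` leaves a nontrivial relation
`∑ j, q_j(z) h(z + j) = 0` with `q_j ∈ ℚ[z]` (`dominant_coeff_relation`), valid off a countable set
of `z`. After a translation of `z` its first coefficient is nonzero, and since its left-hand side is
meromorphic, it vanishes off a closed discrete set (`satisfiesAFE_of_countable`).
-/

namespace HolonomicAFE

open Polynomial

/-! ### Exceptional sets of meromorphic identities -/

lemma countable_compl_of_mem_codiscrete {S : Set ℂ} (hS : S ∈ codiscrete ℂ) : Sᶜ.Countable := by
  obtain ⟨hcl, hd⟩ := compl_mem_codiscrete_iff.1 (by rwa [compl_compl] : Sᶜᶜ ∈ codiscrete ℂ)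
  exact hcl.isLindelof.countable_of_isDiscrete hd

/-- A meromorphic function vanishing off a countable set vanishes off a closed discrete set: a
punctured disc on which it has no zeros would be countable. -/
lemma eventually_codiscrete_eq_zero_of_countable {F : ℂ → ℂ} (hF : MeromorphicOn F Set.univ)
    (hc : {z | F z ≠ 0}.Countable) : ∀ᶠ z in codiscrete ℂ, F z = 0 := by
  change {z | F z = 0} ∈ codiscreteWithin Set.univ
  rw [mem_codiscreteWithin_iff_forall_mem_nhdsNE]
  intro z₀ _
  rw [Set.compl_univ, Set.union_empty]
  rcases (hF z₀ trivial).eventually_eq_zero_or_eventually_ne_zero with h | h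
  · exact h
  · exfalso
    rw [eventually_nhdsWithin_iff, eventually_nhds_iff] at h
    obtain ⟨t, ht, hto, hz⟩ := h
    have hd' : Dense ({z | F z ≠ 0} ∪ {z₀})ᶜ := (hc.union (Set.countable_singleton _)).dense_compl ℝ
    obtain ⟨y, hyt, hy⟩ := hd'.inter_open_nonempty t hto ⟨z₀, hz⟩
    simp only [Set.mem_compl_iff, Set.mem_union, Set.mem_ofPred_eq, Set.mem_singleton_iff,
      not_or, not_not] at hyt hy
    exact ht y hyt hy.2 hy.1

/-! ### Rational functions of `n` and `z` as germs in `n` -/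

/-- Evaluation of `p ∈ ℚ[z][n]` at a fixed `z`, as a sequence in `n`. -/
noncomputable def evalSeq (z : ℂ) : ℚ[X][X] →+* (ℕ → ℂ) :=
  RingHom.pi fun n => eval₂RingHom (eval₂RingHom (algebraMap ℚ ℂ) z) (n : ℂ)

lemma evalSeq_apply (z : ℂ) (p : ℚ[X][X]) (n : ℕ) : evalSeq z p n = evalPoly p n z := rfl

lemma eval₂RingHom_injective {z : ℂ} (hz : Transcendental ℚ z) :
    Function.Injective (eval₂RingHom (algebraMap ℚ ℂ) z) :=
  transcendental_iff_injective.1 hz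

lemma eventually_evalPoly_ne_zero {z : ℂ} (hz : Transcendental ℚ z) {p : ℚ[X][X]} (hp : p ≠ 0) :
    ∀ᶠ n : ℕ in atTop, evalPoly p n z ≠ 0 := by
  have hq : p.map (eval₂RingHom (algebraMap ℚ ℂ) z) ≠ 0 :=
    (Polynomial.map_ne_zero_iff (eval₂RingHom_injective hz)).2 hp
  have hfin : {x : ℂ | (p.map (eval₂RingHom (algebraMap ℚ ℂ) z)).IsRoot x}.Finite :=
    finite_setOfPred_isRoot hq
  have := hfin.preimage (f := fun n : ℕ => (n : ℂ)) (Nat.cast_injective.injOn)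
  rw [← Nat.cofinite_eq_atTop]
  filter_upwards [this.compl_mem_cofinite] with n hn h0
  exact hn (by simpa [IsRoot, eval_map, evalPoly] using h0)

/-- The germ at `n = ∞` of the sequence `p(n, z)`, for `p ∈ ℚ[z][n]` and a fixed `z`. -/
noncomputable def polyGerm (z : ℂ) : ℚ[X][X] →+* Germ (atTop : Filter ℕ) ℂ :=
  (Germ.coeRingHom atTop).comp (evalSeq z)

lemma isUnit_polyGerm {z : ℂ} (hz : Transcendental ℚ z) {p : ℚ[X][X]} (hp : p ≠ 0) :
    IsUnit (polyGerm z p) := by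
  refine IsUnit.of_mul_eq_one (((evalSeq z p)⁻¹ : ℕ → ℂ) : Germ atTop ℂ) ?_
  refine Germ.coe_eq.2 ?_
  filter_upwards [eventually_evalPoly_ne_zero hz hp] with n hn
  exact mul_inv_cancel₀ hn

/-- The germ at `n = ∞` of `a(n, z)`, for `a ∈ ℚ(n, z)` and a fixed transcendental `z`. It is defined
by the universal property of the fraction field, which makes it a ring homomorphism; `ratGerm_eq`
identifies it with the germ of `evalRat`. -/
noncomputable def ratGerm (z : ℂ) (hz : Transcendental ℚ z) : RatNZ →+* Germ (atTop : Filter ℕ) ℂ :=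
  IsLocalization.lift (M := nonZeroDivisors ℚ[X][X]) (g := polyGerm z)
    fun y => isUnit_polyGerm hz (nonZeroDivisors.ne_zero y.2)

lemma ratGerm_algebraMap {z : ℂ} (hz : Transcendental ℚ z) (p : ℚ[X][X]) :
    ratGerm z hz (algebraMap _ _ p) = polyGerm z p :=
  IsLocalization.lift_eq _ _

lemma ratGerm_eq {z : ℂ} (hz : Transcendental ℚ z) (a : RatNZ) :
    ratGerm z hz a = ((fun n => evalRat a n z : ℕ → ℂ) : Germ atTop ℂ) := by
  have hden : (IsFractionRing.den ℚ[X][X] a : ℚ[X][X]) ≠ 0 :=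
    nonZeroDivisors.ne_zero (SetLike.coe_mem _)
  refine (isUnit_polyGerm hz hden).mul_right_cancel ?_
  rw [← ratGerm_algebraMap hz, ← map_mul]
  have : a * algebraMap _ _ (IsFractionRing.den ℚ[X][X] a : ℚ[X][X])
      = algebraMap _ _ (IsFractionRing.num ℚ[X][X] a) := by
    have := IsLocalization.mk'_spec RatNZ (IsFractionRing.num ℚ[X][X] a)
      (IsFractionRing.den ℚ[X][X] a)
    rwa [IsFractionRing.mk'_num_den] at this
  rw [this, ratGerm_algebraMap, ratGerm_algebraMap]
  refine Germ.coe_eq.2 ?_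
  filter_upwards [eventually_evalPoly_ne_zero hz hden] with n hn
  exact (div_mul_cancel₀ _ hn).symm

/-! ### Elimination of the shifts in `n` -/

/-- A holonomic sequence satisfies a nontrivial polynomial recurrence in the shifts of `z` alone, for
all large `n` (depending on `z`) and all `z` off a countable set. -/
theorem exists_shift_relation {u : ℕ → ℂ → ℂ} (hu : IsHolonomic u) :
    ∃ (M : ℕ) (P : Fin M → ℚ[X][X]), P ≠ 0 ∧ ∃ E : Set ℂ, E.Countable ∧ ∀ z ∉ E,
      ∀ᶠ n : ℕ in atTop, ∑ j, evalPoly (P j) n z * u n (z + (j : ℕ)) = 0 := by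
  obtain ⟨N, hN⟩ := hu
  choose c hc using fun j => hN 0 j
  have hdep : ¬ LinearIndependent RatNZ (fun j : Fin (N * N + 1) => c j) := by
    intro hli
    have := hli.fintype_card_le_finrank
    simp [Module.finrank_pi_fintype] at this
  rw [← LinearIndependent.iff_fractionRing (R := ℚ[X][X]), Fintype.not_linearIndependent_iff] at hdep
  obtain ⟨P, hsum, j₀, hj₀⟩ := hdep
  refine ⟨N * N + 1, P, fun h => hj₀ (congrFun h j₀), ?_⟩
  choose n₀ hn₀ using fun j => eventually_atTop.1 (hc j)
  let good : ℕ → ℕ → Set ℂ := fun j n => {z | u (n + 0) (z + j) =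
        ∑ a : Fin N, ∑ b : Fin N, evalRat (c j a b) n z * u (n + a) (z + b)}
  refine ⟨{z | IsAlgebraic ℚ z} ∪ ⋃ j, ⋃ n, ⋃ (_ : n₀ j ≤ n), (good j n)ᶜ, ?_, ?_⟩
  · refine (Algebraic.countable ℚ ℂ).union (Set.countable_iUnion fun j => Set.countable_iUnion
      fun n => Set.countable_iUnion fun hn => ?_)
    exact countable_compl_of_mem_codiscrete (hn₀ j n hn)
  · intro z hzE
    simp only [Set.mem_union, Set.mem_iUnion, not_or, not_exists, Set.mem_ofPred_eq,
      Set.mem_compl_iff, not_not] at hzE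
    obtain ⟨hz, hrel⟩ := hzE
    change Transcendental ℚ z at hz
    let U : ℕ → ℕ → Germ (atTop : Filter ℕ) ℂ := fun a b => ((fun n => u (n + a) (z + b) : ℕ → ℂ) : Germ atTop ℂ)
    have hU : ∀ j, U 0 j = ∑ a : Fin N, ∑ b : Fin N, ratGerm z hz (c j a b) * U a b := by
      intro j
      have : (∑ a : Fin N, ∑ b : Fin N, ratGerm z hz (c j a b) * U a b) =
          Germ.coeRingHom atTop (∑ a : Fin N, ∑ b : Fin N,
            (fun n => evalRat (c j a b) n z) * (fun n : ℕ => u (n + a) (z + b))) := by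
        simp only [map_sum, map_mul, ratGerm_eq]
        rfl
      rw [this]
      refine Germ.coe_eq.2 ?_
      filter_upwards [eventually_ge_atTop (n₀ j)] with n hn
      have h1 : u (n + 0) (z + j) =
          ∑ a : Fin N, ∑ b : Fin N, evalRat (c j a b) n z * u (n + a) (z + b) := hrel j n hn
      simpa using h1
    -- Expand `U 0 j` in the `U a b`: the coefficient of `U a b` is the linear dependency at `(a, b)`.
    have key : ∑ j, polyGerm z (P j) * U 0 (j : ℕ) = 0 := by
      have hcoef : ∀ a b : Fin N, ∑ j, polyGerm z (P j) * ratGerm z hz (c j a b) = 0 := by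
        intro a b
        have h1 : ∑ j, algebraMap _ RatNZ (P j) * c j a b = 0 := by
          have := congrFun (congrFun hsum a) b
          simp only [Finset.sum_apply, Pi.smul_apply] at this
          exact (Finset.sum_congr rfl fun j _ => (Algebra.smul_def _ _).symm).trans this
        have h2 := congrArg (ratGerm z hz) h1
        simpa only [map_sum, map_mul, ratGerm_algebraMap, map_zero] using h2
      calc ∑ j, polyGerm z (P j) * U 0 (j : ℕ)
          = ∑ j, ∑ a : Fin N, ∑ b : Fin N, polyGerm z (P j) * ratGerm z hz (c j a b) * U a b := by
            simp only [hU, Finset.mul_sum, mul_assoc]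
        _ = ∑ a : Fin N, ∑ b : Fin N, (∑ j, polyGerm z (P j) * ratGerm z hz (c j a b)) * U a b := by
            rw [Finset.sum_comm]
            refine Finset.sum_congr rfl fun a _ => ?_
            rw [Finset.sum_comm]
            simp only [Finset.sum_mul]
        _ = 0 := by simp [hcoef]
    have key' : Germ.coeRingHom atTop (∑ j : Fin (N * N + 1),
        evalSeq z (P j) * fun n : ℕ => u n (z + (j : ℕ))) = 0 := by
      rw [map_sum, ← key]
      simp only [map_mul]
      rfl
    filter_upwards [Germ.coe_eq.1 key'] with n hn
    simpa [evalSeq_apply] using hn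

/-! ### Shifting the shell in `z` -/

lemma eventually_natCast_add_ne (w x : ℂ) : ∀ᶠ n : ℕ in atTop, (n : ℂ) + w ≠ x := by
  have := (Set.subsingleton_singleton (a := x - w)).finite.preimage (f := fun n : ℕ => (n : ℂ))
    Nat.cast_injective.injOn
  rw [← Nat.cofinite_eq_atTop]
  filter_upwards [this.compl_mem_cofinite] with n hn h
  exact hn (by simp [← h])

lemma eventually_Gamma_ne_zero (w : ℂ) : ∀ᶠ n : ℕ in atTop, Complex.Gamma (n + w) ≠ 0 := by
  filter_upwards [eventually_gt_atTop ⌈-w.re⌉₊] with n hn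
  refine Complex.Gamma_ne_zero_of_re_pos ?_
  have := Nat.lt_of_ceil_lt hn
  simp
  linarith

lemma natCast_add_isEquivalent (w : ℂ) :
    (fun n : ℕ => (n : ℂ) + w) ~[atTop] (fun n : ℕ => (n : ℂ)) := by
  refine IsEquivalent.add_isLittleO IsEquivalent.refl ?_
  refine isLittleO_const_left.2 (Or.inr ?_)
  simpa [Function.comp_def] using tendsto_natCast_atTop_atTop (R := ℝ)

lemma Gamma_shift_isEquivalent (w : ℂ) (k : ℤ) :
    (fun n : ℕ => Complex.Gamma (n + w + k)) ~[atTop]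
      (fun n : ℕ => (n : ℂ) ^ k * Complex.Gamma (n + w)) := by
  induction k using Int.induction_on with
  | zero => simpa using IsEquivalent.refl
  | succ k ih =>
    refine (((natCast_add_isEquivalent (w + k)).mul ih).congr_left ?_).congr_right ?_
    · filter_upwards [eventually_natCast_add_ne (w + k) 0] with n hn
      simp only [Pi.mul_apply]
      push_cast
      rw [← add_assoc] at hn ⊢
      rw [← add_assoc, Complex.Gamma_add_one _ hn]
    · filter_upwards [eventually_ne_atTop 0] with n hn
      simp only [Pi.mul_apply]
      rw [zpow_add_one₀ (Nat.cast_ne_zero.2 hn)]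
      ring
  | pred k ih =>
    refine ((ih.div (natCast_add_isEquivalent (w - k - 1))).congr_left ?_).congr_right ?_
    · filter_upwards [eventually_natCast_add_ne (w - k - 1) 0] with n hn
      simp only [Pi.div_apply]
      push_cast
      rw [div_eq_iff hn, show (n : ℂ) + w + -k = (n + (w - k - 1)) + 1 by ring,
        Complex.Gamma_add_one _ hn, show (n : ℂ) + w + (-k - 1) = n + (w - k - 1) by ring]
      ring
    · filter_upwards [eventually_ne_atTop 0] with n hn
      simp only [Pi.div_apply]
      rw [zpow_sub_one₀ (Nat.cast_ne_zero.2 hn)]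
      ring

lemma eventually_shell_ne_zero {l : ℂ} (hl : l ≠ 0) (c₁ : ℤ) (c₀ : ℂ) {s : ℕ} (α : Fin s → ℤ)
    (β : Fin s → ℂ) (m : Fin s → ℤ) (z : ℂ) :
    ∀ᶠ n : ℕ in atTop, shell l c₁ c₀ α β m n z ≠ 0 := by
  have hG : ∀ᶠ n : ℕ in atTop, ∀ j, Complex.Gamma (n + (α j * z + β j)) ≠ 0 :=
    eventually_all.2 fun j => eventually_Gamma_ne_zero _
  filter_upwards [hG, eventually_ne_atTop 0] with n hn h0
  refine mul_ne_zero (mul_ne_zero (pow_ne_zero _ hl) ?_) (Finset.prod_ne_zero_iff.2 fun j _ => ?_)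
  · rw [Complex.cpow_def_of_ne_zero (Nat.cast_ne_zero.2 h0)]
    exact Complex.exp_ne_zero _
  · rw [add_assoc]
    exact zpow_ne_zero _ (hn j)

lemma prod_zpow_eq_zpow_sum {ι : Type*} {x : ℂ} (hx : x ≠ 0) (t : Finset ι) (f : ι → ℤ) :
    ∏ j ∈ t, x ^ f j = x ^ ∑ j ∈ t, f j := by
  induction t using Finset.cons_induction with
  | empty => simp
  | cons a t ha ih => rw [Finset.prod_cons, Finset.sum_cons, zpow_add₀ hx, ih]

lemma shell_shift_isEquivalent (l : ℂ) (c₁ : ℤ) (c₀ : ℂ) {s : ℕ} (α : Fin s → ℤ)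
    (β : Fin s → ℂ) (m : Fin s → ℤ) (z : ℂ) (k : ℕ) :
    (fun n : ℕ => shell l c₁ c₀ α β m n (z + k)) ~[atTop]
      (fun n : ℕ => (n : ℂ) ^ ((c₁ + ∑ j, α j * m j) * k) * shell l c₁ c₀ α β m n z) := by
  have hprod := IsEquivalent.finsetProd (s := Finset.univ) fun j (_ : j ∈ Finset.univ) =>
    (Gamma_shift_isEquivalent (α j * z + β j) (α j * k)).zpow (m j)
  have hpow : (fun n : ℕ => l ^ n * (n : ℂ) ^ ((c₁ : ℂ) * (z + k) + c₀)) ~[atTop]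
      (fun n : ℕ => l ^ n * (n : ℂ) ^ ((c₁ : ℂ) * (z + k) + c₀)) := IsEquivalent.refl
  refine ((hpow.mul hprod).congr_left ?_).congr_right ?_
  · refine Eventually.of_forall fun n => ?_
    simp only [shell, Pi.mul_apply, Pi.pow_apply]
    congr 1
    refine Finset.prod_congr rfl fun j _ => ?_
    congr 2
    push_cast
    ring
  · filter_upwards [eventually_ne_atTop 0] with n hn
    have hn' : (n : ℂ) ≠ 0 := Nat.cast_ne_zero.2 hn
    simp only [shell, Pi.mul_apply, Pi.pow_apply, mul_zpow,
      Finset.prod_mul_distrib, ← add_assoc]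
    have h1 : (n : ℂ) ^ ((c₁ : ℂ) * (z + k) + c₀) = (n : ℂ) ^ (c₁ * k) * (n : ℂ) ^ ((c₁ : ℂ) * z + c₀) := by
      rw [← Complex.cpow_intCast, ← Complex.cpow_add _ _ hn']
      congr 1
      push_cast
      ring
    have h2 : ∏ j, ((n : ℂ) ^ (α j * k)) ^ m j = (n : ℂ) ^ ((∑ j, α j * m j) * k) := by
      rw [Finset.sum_mul, ← prod_zpow_eq_zpow_sum hn']
      refine Finset.prod_congr rfl fun j _ => ?_
      rw [← zpow_mul]
      congr 1
      ring
    rw [h1, h2, add_mul, zpow_add₀ hn']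
    ring

/-! ### Comparison of the dominant powers of `n` -/

lemma tendsto_evalPoly_div_pow (p : ℚ[X][X]) (z : ℂ) :
    Tendsto (fun n : ℕ => evalPoly p n z / (n : ℂ) ^ p.natDegree) atTop
      (𝓝 (p.leadingCoeff.eval₂ (algebraMap ℚ ℂ) z)) := by
  set φ := eval₂RingHom (algebraMap ℚ ℂ) z with hφ
  -- `p(n) / n ^ deg p` is the reversed polynomial at `1 / n`, which is continuous at `0`.
  have hcont : Continuous fun y : ℂ => p.reverse.eval₂ φ y := by
    simp only [← eval_map]
    exact Polynomial.continuous _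
  have h0 : p.reverse.eval₂ φ 0 = p.leadingCoeff.eval₂ (algebraMap ℚ ℂ) z := by
    rw [eval₂_at_zero, coeff_zero_reverse]
    rfl
  have hlim := (hcont.tendsto 0).comp (tendsto_inv_atTop_nhds_zero_nat (𝕜 := ℂ))
  rw [h0] at hlim
  refine hlim.congr' ?_
  filter_upwards [eventually_ne_atTop 0] with n hn
  have hn' : (n : ℂ) ≠ 0 := Nat.cast_ne_zero.2 hn
  let _ : Invertible (n : ℂ) := invertibleOfNonzero hn'
  rw [eq_div_iff (pow_ne_zero _ hn'), evalPoly, ← hφ, ← eval₂_reverse_mul_pow φ (n : ℂ) p,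
    invOf_eq_inv]
  rfl

/-- If `v_n(j) ~ n ^ (δ j) S_n H_j` satisfies `∑ j, P_j(n, z) v_n(j) = 0` for all large `n`, then the
`H_j` satisfy the relation formed by the leading coefficients in `n` of those `P_j` for which
`deg_n P_j + δ j` is maximal. The coefficients `q` depend on `P` and `δ` only, not on `z`. -/
theorem dominant_coeff_relation {M : ℕ} (P : Fin M → ℚ[X][X]) (hP : P ≠ 0) (δ : ℤ) :
    ∃ q : Fin M → ℚ[X], q ≠ 0 ∧ ∀ (z : ℂ) (v : ℕ → Fin M → ℂ) (S : ℕ → ℂ) (H : Fin M → ℂ),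
      (∀ᶠ n in atTop, S n ≠ 0) →
      (∀ᶠ n in atTop, ∑ j, evalPoly (P j) n z * v n j = 0) →
      (∀ j, (fun n => v n j) ~[atTop] fun n => (n : ℂ) ^ (δ * (j : ℕ)) * S n * H j) →
      ∑ j, (q j).eval₂ (algebraMap ℚ ℂ) z * H j = 0 := by
  obtain ⟨i₀, hi₀⟩ := Function.ne_iff.1 hP
  let w : Fin M → ℤ := fun j => (P j).natDegree + δ * (j : ℕ)
  obtain ⟨j₀, hj₀, hmax⟩ := (Finset.univ.filter fun j => P j ≠ 0).exists_max_image w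
    ⟨i₀, by simpa using hi₀⟩
  have hj₀' : P j₀ ≠ 0 := (Finset.mem_filter.1 hj₀).2
  refine ⟨fun j => if w j = w j₀ then (P j).leadingCoeff else 0, ?_, ?_⟩
  · intro h
    have := congrFun h j₀
    simp [hj₀'] at this
  intro z v S H hS hrel hv
  have hterm : ∀ j, Tendsto (fun n : ℕ => evalPoly (P j) n z * v n j / ((n : ℂ) ^ w j₀ * S n)) atTop
      (𝓝 ((if w j = w j₀ then (P j).leadingCoeff else 0).eval₂ (algebraMap ℚ ℂ) z * H j)) := by
    intro j
    by_cases hPj : P j = 0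
    -- A zero `P j` has `natDegree` zero, so `w j` may exceed `w j₀`.
    · simp [hPj, evalPoly]
    have hle : w j ≤ w j₀ := hmax j (by simpa using hPj)
    have h1 := tendsto_evalPoly_div_pow (P j) z
    have h2 : Tendsto (fun n : ℕ => v n j / ((n : ℂ) ^ (δ * (j : ℕ)) * S n)) atTop (𝓝 (H j)) := by
      have : (fun n : ℕ => v n j / ((n : ℂ) ^ (δ * (j : ℕ)) * S n)) ~[atTop]
          fun n : ℕ => ((n : ℂ) ^ (δ * (j : ℕ)) * S n * H j) / ((n : ℂ) ^ (δ * (j : ℕ)) * S n) :=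
        (hv j).div IsEquivalent.refl
      refine this.symm.tendsto_nhds (tendsto_const_nhds.congr' ?_)
      filter_upwards [hS, eventually_ne_atTop 0] with n hn h0
      have hn' : (n : ℂ) ≠ 0 := Nat.cast_ne_zero.2 h0
      field_simp
    have h3 : Tendsto (fun n : ℕ => (n : ℂ) ^ (w j - w j₀)) atTop
        (𝓝 (if w j = w j₀ then 1 else 0)) := by
      split_ifs with heq
      · simp [heq]
      · obtain ⟨e, he⟩ := Int.eq_ofNat_of_zero_le (sub_nonneg.2 hle)
        have he0 : e ≠ 0 := by omega
        have hfun : (fun n : ℕ => (n : ℂ) ^ (w j - w j₀)) = fun n : ℕ => ((n : ℂ)⁻¹) ^ e := by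
          funext n
          rw [← neg_sub, he]
          simp
        rw [hfun]
        simpa [he0] using (tendsto_inv_atTop_nhds_zero_nat (𝕜 := ℂ)).pow e
    have h4 := (h1.mul h2).mul h3
    have hlim : (P j).leadingCoeff.eval₂ (algebraMap ℚ ℂ) z * H j * (if w j = w j₀ then 1 else 0)
        = (if w j = w j₀ then (P j).leadingCoeff else 0).eval₂ (algebraMap ℚ ℂ) z * H j := by
      split_ifs <;> simp
    rw [hlim] at h4
    refine h4.congr' ?_
    filter_upwards [hS, eventually_ne_atTop 0] with n hn h0
    have hn' : (n : ℂ) ≠ 0 := Nat.cast_ne_zero.2 h0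
    have hw : (n : ℂ) ^ (w j - w j₀) =
        (n : ℂ) ^ (P j).natDegree * (n : ℂ) ^ (δ * (j : ℕ)) / (n : ℂ) ^ w j₀ := by
      rw [zpow_sub₀ hn', zpow_add₀ hn', zpow_natCast]
    rw [hw]
    field_simp
  have hsum := tendsto_finsetSum Finset.univ fun j (_ : j ∈ Finset.univ) => hterm j
  refine tendsto_nhds_unique hsum (tendsto_const_nhds.congr' ?_)
  filter_upwards [hrel] with n hn
  rw [← Finset.sum_div, hn, zero_div]

/-! ### The functional equation -/

theorem satisfiesAFE_of_countable {h : ℂ → ℂ} (hh : MeromorphicOn h Set.univ) {M : ℕ}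
    (q : ℕ → ℚ[X]) (hq : ∃ j < M, q j ≠ 0) {E : Set ℂ} (hE : E.Countable)
    (hrel : ∀ z ∉ E, ∑ j ∈ Finset.range M, (q j).eval₂ (algebraMap ℚ ℂ) z * h (z + j) = 0) :
    ∃ r, SatisfiesAFE h r := by
  have hne : ((Finset.range M).filter fun j => q j ≠ 0).Nonempty := by
    obtain ⟨j, hj, hqj⟩ := hq
    exact ⟨j, by simp [hj, hqj]⟩
  obtain ⟨a, ha, hamin⟩ := Finset.exists_min_image _ (id : ℕ → ℕ) hne
  obtain ⟨b, hb, hbmax⟩ := Finset.exists_max_image _ (id : ℕ → ℕ) hne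
  have hab : a ≤ b := hamin b hb
  simp only [Finset.mem_filter, Finset.mem_range, id, and_imp] at ha hb hamin hbmax
  -- The substitution `z ↦ z - a` turns the lowest shift `h (z + a)` into `h z`.
  let Q : ℕ → ℚ[X] := fun k => taylor (-(a : ℚ)) (q (a + k))
  have hQ : ∀ k, q (a + k) ≠ 0 → algebraMap ℚ[X] (RatFunc ℚ) (Q k) ≠ 0 := by
    intro k hk
    rw [Ne, map_eq_zero_iff _ (RatFunc.algebraMap_injective ℚ)]
    exact fun h0 => hk ((taylor_injective _).eq_iff' (map_zero _) |>.1 h0)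
  have hQe : ∀ k z, (Q k).eval₂ (algebraMap ℚ ℂ) z =
      (q (a + k)).eval₂ (algebraMap ℚ ℂ) (z - a) := by
    intro k z
    simp [Q, taylor_apply, eval₂_comp, sub_eq_add_neg]
  refine ⟨b - a, fun k => algebraMap ℚ[X] (RatFunc ℚ) (Q k), hQ 0 ha.2,
    hQ _ (by rw [Nat.add_sub_cancel' hab]; exact hb.2), ?_⟩
  simp only [RatFunc.eval_algebraMap, Algebra.algebraMap_self, RingHom.id_apply, hQe]
  refine eventually_codiscrete_eq_zero_of_countable ?_ ?_
  · intro z _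
    refine MeromorphicAt.fun_sum fun k _ => MeromorphicAt.fun_mul ?_ ?_
    · have hz : AnalyticAt ℂ (fun z : ℂ => z - a) z := by fun_prop
      exact (hz.aeval_polynomial (q (a + k))).meromorphicAt
    · exact MeromorphicAt.comp_analyticAt (g := fun z : ℂ => z + k) (hh (z + k) trivial)
        (by fun_prop)
  · refine (hE.preimage (f := fun z : ℂ => z - a) sub_left_injective).mono fun z hz => ?_
    by_contra hzE
    refine hz ?_
    rw [← hrel (z - a) hzE]
    have hsub : Finset.Ico a (b + 1) ⊆ Finset.range M := fun j hj => by
      simp only [Finset.mem_Ico, Finset.mem_range] at hj ⊢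
      omega
    rw [← Finset.sum_subset hsub, Finset.sum_Ico_eq_sum_range, Nat.sub_add_comm hab]
    · refine Finset.sum_congr rfl fun k _ => ?_
      congr 2
      push_cast
      ring
    · intro j hjM hj
      have : q j = 0 := by
        by_contra h0
        rw [Finset.mem_range] at hjM
        exact hj (Finset.mem_Ico.2 ⟨hamin j hjM h0, Nat.lt_succ_of_le (hbmax j hjM h0)⟩)
      simp [this]

end HolonomicAFE

theorem proposition6p3
    (u : ℕ → ℂ → ℂ) (hu : HolonomicAFE.IsHolonomic u)
    (l : ℂ) (hl : l ≠ 0) (c₁ : ℤ) (c₀ : ℂ)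
    (s : ℕ) (α : Fin s → ℤ) (β : Fin s → ℂ) (m : Fin s → ℤ)
    (h : ℂ → ℂ) (hh : MeromorphicOn h Set.univ)
    (hasymp : ∀ᶠ z : ℂ in codiscrete ℂ,
      (fun n : ℕ => u n z) ~[atTop]
        (fun n : ℕ => HolonomicAFE.shell l c₁ c₀ α β m n z * h z)) :
    ∃ r : ℕ, HolonomicAFE.SatisfiesAFE h r := by
  obtain ⟨M, P, hP, E, hE, hrel⟩ := HolonomicAFE.exists_shift_relation hu
  obtain ⟨q, hq, hdom⟩ := HolonomicAFE.dominant_coeff_relation P hP (c₁ + ∑ j, α j * m j)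
  have hB := HolonomicAFE.countable_compl_of_mem_codiscrete hasymp
  obtain ⟨j₀, hj₀⟩ := Function.ne_iff.1 hq
  refine HolonomicAFE.satisfiesAFE_of_countable hh (M := M)
    (fun j => if hj : j < M then q ⟨j, hj⟩ else 0) ⟨j₀, j₀.2, by simpa using hj₀⟩
    (hE.union (Set.countable_iUnion fun j : ℕ =>
      hB.preimage (f := fun z : ℂ => z + j) (add_left_injective _))) fun z hz => ?_
  simp only [Set.mem_union, Set.mem_iUnion, Set.mem_preimage, Set.mem_compl_iff, not_or,
    not_exists, not_not, Set.mem_ofPred_eq] at hz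
  rw [Finset.sum_range]
  simp only [Fin.is_lt, dite_true, Fin.eta]
  refine hdom z (fun n j => u n (z + (j : ℕ))) (HolonomicAFE.shell l c₁ c₀ α β m · z)
    (fun j => h (z + (j : ℕ))) (HolonomicAFE.eventually_shell_ne_zero hl c₁ c₀ α β m z)
    (hrel z hz.1) fun j => ?_
  exact (hz.2 j).trans
    ((HolonomicAFE.shell_shift_isEquivalent l c₁ c₀ α β m z j).mul IsEquivalent.refl)
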